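/- Let $0\le d\le n$ be integers, let $X_1,\dots,X_n$ be independent $\{0,1\}$-valued random variables (not necessarily identically distributed), let $\mathcal I_{n,m}$ denote the family of subsets of $\{1,\dots,n\}$ of size $m$, and let $\mathcal T\subset\mathbb R^{\mathcal I_{n,d}}$ be a nonempty compact set of vectors $t=(t_I)_{I\in\mathcal I_{n,d}}$ with nonnegative entries. Put $$Z=\sup_{t\in\mathcal T}\ \sum_{I\in\mathcal I_{n,d}}\Big(\prod_{i\in I}X_i\Big)t_I,$$ and, for $k=0,1,\dots,d-1$, $$M_k=\max_{J\in\mathcal I_{n,d-k}}\ \sup_{t\in\mathcal T}\ \sum_{I\in\mathcal I_{n,d}:\,J\subseteq I}\Big(\prod_{j\in I\setminus J}X_j\Big)t_I .$$ Write $x_+=\max(x,0)$, $\|Y\|_q=(\mathbb E|Y|^q)^{1/q}$, and $\kappa=\frac{\sqrt e}{2(\sqrt e-1)}$. Then $Z$ and all the $M_k$ are integrable, and for every real $q\ge 2$, $$\|(Z-\mathbb E Z)_+\|_q\le 2\sum_{j=1}^d\left\{(\kappa q)^{j/2}\sqrt{\frac{d!}{(d-j)!}}\,\sqrt{\mathbb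 E[Z]\,\mathbb E[M_{d-j}]}+(\kappa q)^j\,\frac{d!}{(d-j)!}\,\mathbb E[M_{d-j}]\right\}.$$ -/

import Mathlib

/-- The family of subsets of size `d` of an `n`-element set. -/
abbrev SubsetsOfSize (n d : ℕ) : Type := {I : Finset (Fin n) // I.card = d}

/-- The constant `κ = √e / (2 (√e - 1))`. -/
noncomputable def kappa : ℝ :=
  Real.sqrt (Real.exp 1) / (2 * (Real.sqrt (Real.exp 1) - 1))

/-- The supremum over `t ∈ T` of the Boolean polynomials `∑_I (∏_{i ∈ I} x_i) t_I`,
the sum being over all subsets `I` of size `d`. -/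
noncomputable def boolSup {n d : ℕ} (T : Set (SubsetsOfSize n d → ℝ)) (x : Fin n → ℝ) : ℝ :=
  ⨆ t : T, ∑ I : SubsetsOfSize n d, (∏ i ∈ I.1, x i) * t.1 I

/-- The maximum, over all sets `J` of size `d - k`, of the supremum over `t ∈ T` of the
partial sums `∑_{I ⊇ J} (∏_{i ∈ I \ J} x_i) t_I`; used for `k < d`. -/
noncomputable def maxPartial {n d : ℕ} (T : Set (SubsetsOfSize n d → ℝ)) (k : ℕ)
    (x : Fin n → ℝ) : ℝ :=
  ⨆ J : SubsetsOfSize n (d - k), ⨆ t : T,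
    ∑ I : SubsetsOfSize n d with J.1 ⊆ I.1, (∏ i ∈ I.1 \ J.1, x i) * t.1 I

/-! The argument is the entropy method for moments, carried out on the finite cube under a product
of Bernoulli laws and iterated along the chain `M_d = Z, M_{d-1}, ..., M_0`.

Moment inequality. For `1 ≤ r ≤ 2` the entropy `E f^r - (E f)^r` is subadditive over independent
coordinates (`cubeExp_rpow_sub_le_sum_twoPointEntropy`), because the two-point entropy is jointly
convex. With `r = q/(q-1)` and `f = D^(q-1)`, where `D = (Z - E Z)_+` and `Z` is coordinatewise
nondecreasing, this gives `E D^q ≤ (E D^(q-1))^(q/(q-1)) + (q/2) E[V D^(q-2)]`, where `V` sums the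
squared decrements of `Z` when one coordinate is switched off. Hölder and an induction on `q` in
unit steps, started by Efron–Stein, yield `‖D‖_q² ≤ κ q ‖V‖_{q/2}` (`cubeNorm_upperDev_sq_le`); `κ`
is the constant that closes this induction.

Self-bounding. If `V ≤ W Z`, Cauchy–Schwarz and `‖Z‖_q ≤ E Z + ‖D‖_q` turn this into a quadratic
inequality for `‖D‖_q`. It gives both `‖Z‖_q ≤ 2 E Z + κ q ‖W‖_q` and `‖D‖_q ≤ √(κ q ‖W‖_q E Z) + κ
q ‖W‖_q`.

Chain. Fix `J` and `t` optimal for `M_k`. Switching off `i` lowers `M_k` by at most the terms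
containing `x_i`. Each such loss is at most `M_{k-1}`, and the losses add up to `k M_k` since every
monomial has degree `k`. So `M_k` is self-bounded with `W = k M_{k-1}` (`sum_sq_maxPartial_sub_le`).
The first bound, used for `k < d`, unrolls to a bound on `‖M_{d-1}‖_q` with factorial ratios; the
second, used once at `k = d`, gives the theorem. -/

/-! ### Joint convexity of the two-point entropy. -/

/-- The weighted power entropy of a two-point distribution. -/
noncomputable def twoPointEntropy (r θ a b : ℝ) : ℝ :=
  (1 - θ) * a ^ r + θ * b ^ r - ((1 - θ) * a + θ * b) ^ r

/-- Joint convexity of `(x, c) ↦ c² / x^(2-r)`: Cauchy–Schwarz handles the quotient, and concavity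
of `x ↦ x^(2-r)` replaces the mean of the denominators by the denominator at the mean. This is what
makes the second derivative of the entropy nonnegative. -/
lemma rpow_sub_two_mul_sq_le {r θ α β c d : ℝ} (hr1 : 1 ≤ r) (hr2 : r ≤ 2) (hθ0 : 0 ≤ θ)
    (hθ1 : θ ≤ 1) (hα : 0 < α) (hβ : 0 < β) :
    ((1 - θ) * α + θ * β) ^ (r - 2) * ((1 - θ) * c + θ * d) ^ 2 ≤
      (1 - θ) * (α ^ (r - 2) * c ^ 2) + θ * (β ^ (r - 2) * d ^ 2) := by
  have hm : 0 < (1 - θ) * α + θ * β := by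
    rcases hθ0.eq_or_lt with h | h
    · subst h; simpa using hα
    · have := mul_nonneg (sub_nonneg.2 hθ1) hα.le
      have := mul_pos h hβ
      linarith
  have hconc : (1 - θ) * α ^ (2 - r) + θ * β ^ (2 - r) ≤ ((1 - θ) * α + θ * β) ^ (2 - r) := by
    have := (Real.concaveOn_rpow (p := 2 - r) (by linarith) (by linarith)).2
      (Set.mem_Ici.2 hα.le) (Set.mem_Ici.2 hβ.le) (sub_nonneg.2 hθ1) hθ0 (by ring)
    simpa using this
  have e : ∀ x : ℝ, 0 < x → x ^ (r - 2) = (x ^ (2 - r))⁻¹ := by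
    intro x hx
    rw [← Real.rpow_neg hx.le]; ring_nf
  rw [e _ hm, e _ hα, e _ hβ]
  have hA : 0 < α ^ (2 - r) := Real.rpow_pos_of_pos hα _
  have hB : 0 < β ^ (2 - r) := Real.rpow_pos_of_pos hβ _
  have hM : 0 < ((1 - θ) * α + θ * β) ^ (2 - r) := Real.rpow_pos_of_pos hm _
  generalize α ^ (2 - r) = A at *
  generalize β ^ (2 - r) = B at *
  generalize ((1 - θ) * α + θ * β) ^ (2 - r) = M at *
  have hR : 0 ≤ (1 - θ) * (A⁻¹ * c ^ 2) + θ * (B⁻¹ * d ^ 2) := by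
    have := sub_nonneg.2 hθ1
    positivity
  have hcs : ((1 - θ) * c + θ * d) ^ 2 ≤
      ((1 - θ) * A + θ * B) * ((1 - θ) * (A⁻¹ * c ^ 2) + θ * (B⁻¹ * d ^ 2)) := by
    have h1 : 0 ≤ (1 - θ) * θ * (A * B) * (A⁻¹ * c - B⁻¹ * d) ^ 2 := by
      have := sub_nonneg.2 hθ1
      positivity
    have h2 : ((1 - θ) * A + θ * B) * ((1 - θ) * (A⁻¹ * c ^ 2) + θ * (B⁻¹ * d ^ 2)) -
        ((1 - θ) * c + θ * d) ^ 2 = (1 - θ) * θ * (A * B) * (A⁻¹ * c - B⁻¹ * d) ^ 2 := by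
      field_simp
      ring
    linarith
  rw [inv_mul_le_iff₀ hM]
  exact hcs.trans (mul_le_mul_of_nonneg_right hconc hR)

/-- The entropy is differentiated twice along the segment. Strict positivity is needed because the
exponent `r - 2` may be negative; the boundary is recovered by continuity in
`convexOn_twoPointEntropy`. -/
lemma twoPointEntropy_le_of_pos {r θ a₀ b₀ a₁ b₁ s t : ℝ} (hr1 : 1 ≤ r) (hr2 : r ≤ 2)
    (hθ0 : 0 ≤ θ) (hθ1 : θ ≤ 1) (ha₀ : 0 < a₀) (hb₀ : 0 < b₀) (ha₁ : 0 < a₁) (hb₁ : 0 < b₁)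
    (hs : 0 ≤ s) (ht : 0 ≤ t) (hst : s + t = 1) :
    twoPointEntropy r θ (s * a₀ + t * a₁) (s * b₀ + t * b₁) ≤
      s * twoPointEntropy r θ a₀ b₀ + t * twoPointEntropy r θ a₁ b₁ := by
  set c := a₁ - a₀ with hc
  set d := b₁ - b₀ with hd
  set e := (1 - θ) * c + θ * d with he
  set m := (1 - θ) * a₀ + θ * b₀ with hm
  have pos : ∀ u v l : ℝ, 0 < u → 0 < v → l ∈ Set.Icc (0 : ℝ) 1 → 0 < u + l * (v - u) := by
    intro u v l hu hv hl
    rcases hl.2.eq_or_lt with h | h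
    · subst h; linarith
    · nlinarith [mul_nonneg hl.1 hv.le, mul_pos (sub_pos.2 h) hu]
  have posm : ∀ u v : ℝ, 0 < u → 0 < v → 0 < (1 - θ) * u + θ * v := by
    intro u v hu hv
    have := pos u v θ hu hv ⟨hθ0, hθ1⟩
    linarith
  have hA : ∀ l ∈ Set.Icc (0 : ℝ) 1, 0 < a₀ + l * c := fun l hl => pos _ _ _ ha₀ ha₁ hl
  have hB : ∀ l ∈ Set.Icc (0 : ℝ) 1, 0 < b₀ + l * d := fun l hl => pos _ _ _ hb₀ hb₁ hl
  have hMeq : ∀ l, m + l * e = (1 - θ) * (a₀ + l * c) + θ * (b₀ + l * d) := by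
    intro l; rw [he, hm]; ring
  have hM : ∀ l ∈ Set.Icc (0 : ℝ) 1, 0 < m + l * e := by
    intro l hl
    rw [hMeq]; exact posm _ _ (hA l hl) (hB l hl)
  have hlin : ∀ u v l : ℝ, HasDerivAt (fun x => u + x * v) v l := by
    intro u v l
    simpa using ((hasDerivAt_id l).mul_const v).const_add u
  have hder : ∀ p u v l : ℝ, 0 < u + l * v →
      HasDerivAt (fun x => (u + x * v) ^ p) (v * p * (u + l * v) ^ (p - 1)) l :=
    fun p u v l h => (hlin u v l).rpow_const (Or.inl h.ne')
  have hconv : ConvexOn ℝ (Set.Icc (0 : ℝ) 1)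
      (fun l => (1 - θ) * (a₀ + l * c) ^ r + θ * (b₀ + l * d) ^ r - (m + l * e) ^ r) := by
    refine convexOn_of_hasDerivWithinAt2_nonneg (convex_Icc 0 1)
      (f' := fun l => (1 - θ) * (c * r * (a₀ + l * c) ^ (r - 1)) +
        θ * (d * r * (b₀ + l * d) ^ (r - 1)) - e * r * (m + l * e) ^ (r - 1))
      (f'' := fun l => (1 - θ) * (c * r * (c * (r - 1) * (a₀ + l * c) ^ (r - 1 - 1))) +
        θ * (d * r * (d * (r - 1) * (b₀ + l * d) ^ (r - 1 - 1))) -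
        e * r * (e * (r - 1) * (m + l * e) ^ (r - 1 - 1))) ?_ ?_ ?_ ?_
    · intro l hl
      exact ((((hder r a₀ c l (hA l hl)).const_mul _).add
        ((hder r b₀ d l (hB l hl)).const_mul _)).sub
          (hder r m e l (hM l hl))).continuousAt.continuousWithinAt
    · intro l hl
      have hl := interior_subset hl
      exact ((((hder r a₀ c l (hA l hl)).const_mul _).add
        ((hder r b₀ d l (hB l hl)).const_mul _)).sub (hder r m e l (hM l hl))).hasDerivWithinAt
    · intro l hl
      have hl := interior_subset hl
      exact (((((hder (r - 1) a₀ c l (hA l hl)).const_mul _).const_mul _).add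
        (((hder (r - 1) b₀ d l (hB l hl)).const_mul _).const_mul _)).sub
          ((hder (r - 1) m e l (hM l hl)).const_mul _)).hasDerivWithinAt
    · intro l hl
      have hl := interior_subset hl
      have key := rpow_sub_two_mul_sq_le (c := c) (d := d) hr1 hr2 hθ0 hθ1 (hA l hl) (hB l hl)
      rw [← hMeq, ← he] at key
      have e2 : r - 1 - 1 = r - 2 := by ring
      rw [e2]
      have h0 : 0 ≤ r * (r - 1) := mul_nonneg (by linarith) (by linarith)
      nlinarith [mul_le_mul_of_nonneg_left key h0]
  have h := hconv.2 (Set.left_mem_Icc.2 zero_le_one) (Set.right_mem_Icc.2 zero_le_one) hs ht hst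
  have hs' : s = 1 - t := by linarith
  simp only [smul_eq_mul, mul_zero, mul_one, zero_add, zero_mul, add_zero, one_mul] at h
  unfold twoPointEntropy
  have e1 : a₀ + t * c = s * a₀ + t * a₁ := by rw [hs', hc]; ring
  have e2 : b₀ + t * d = s * b₀ + t * b₁ := by rw [hs', hd]; ring
  have e3 : m + e = (1 - θ) * a₁ + θ * b₁ := by rw [he, hm, hc, hd]; ring
  have e4 : a₀ + c = a₁ := by rw [hc]; ring
  have e5 : b₀ + d = b₁ := by rw [hd]; ring
  rw [hMeq, e1, e2, e3, e4, e5] at h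
  exact h

lemma convexOn_twoPointEntropy {r θ : ℝ} (hr1 : 1 ≤ r) (hr2 : r ≤ 2) (hθ0 : 0 ≤ θ)
    (hθ1 : θ ≤ 1) :
    ConvexOn ℝ (Set.Ici (0 : ℝ) ×ˢ Set.Ici (0 : ℝ))
      (fun z : ℝ × ℝ => twoPointEntropy r θ z.1 z.2) := by
  refine ⟨(convex_Ici 0).prod (convex_Ici 0), ?_⟩
  rintro ⟨a₀, b₀⟩ ⟨ha₀, hb₀⟩ ⟨a₁, b₁⟩ ⟨ha₁, hb₁⟩ s t hs ht hst
  simp only [Set.mem_Ici] at ha₀ hb₀ ha₁ hb₁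
  simp only [Prod.smul_mk, Prod.mk_add_mk, smul_eq_mul]
  have hcont : Continuous (fun z : ℝ × ℝ => twoPointEntropy r θ z.1 z.2) := by
    unfold twoPointEntropy
    have h : ∀ g : ℝ × ℝ → ℝ, Continuous g → Continuous fun z => g z ^ r :=
      fun g hg => hg.rpow_const fun _ => Or.inr (by linarith)
    exact ((continuous_const.mul (h _ continuous_fst)).add
      (continuous_const.mul (h _ continuous_snd))).sub
        (h _ ((continuous_const.mul continuous_fst).add (continuous_const.mul continuous_snd)))
  -- Shifting all coordinates by `ε > 0` moves both points into the open quadrant and commutes with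
  -- convex combinations; then `ε → 0`.
  have hc : ∀ u v : ℝ, Continuous fun ε : ℝ => twoPointEntropy r θ (u + ε) (v + ε) := fun u v =>
    hcont.comp ((continuous_const.add continuous_id).prodMk (continuous_const.add continuous_id))
  have hlim : ∀ g : ℝ → ℝ, Continuous g →
      Filter.Tendsto g (nhdsWithin 0 (Set.Ioi 0)) (nhds (g 0)) :=
    fun g hg => (hg.tendsto 0).mono_left nhdsWithin_le_nhds
  have := le_of_tendsto_of_tendsto (b := nhdsWithin (0 : ℝ) (Set.Ioi 0))
    (hlim _ (hc (s * a₀ + t * a₁) (s * b₀ + t * b₁)))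
    (hlim _ (((hc a₀ b₀).const_mul s).add ((hc a₁ b₁).const_mul t))) ?_
  · simpa using this
  · filter_upwards [self_mem_nhdsWithin] with ε hε
    have hε : 0 < ε := hε
    have h := twoPointEntropy_le_of_pos (r := r) (θ := θ) (a₀ := a₀ + ε) (b₀ := b₀ + ε)
      (a₁ := a₁ + ε) (b₁ := b₁ + ε) hr1 hr2 hθ0 hθ1 (by linarith) (by linarith) (by linarith)
      (by linarith) hs ht hst
    have e : ∀ u v, s * (u + ε) + t * (v + ε) = s * u + t * v + ε := by
      intro u v
      have : s = 1 - t := by linarith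
      rw [this]; ring
    rwa [e, e] at h

/-! ### Bregman divergences of powers. -/

/-- The tangent line inequality for `x ↦ x ^ r` on the nonnegative half-line. -/
lemma rpow_tangent_le {r u m : ℝ} (hr : 1 < r) (hu : 0 ≤ u) (hm : 0 ≤ m) :
    u ^ r + r * u ^ (r - 1) * (m - u) ≤ m ^ r := by
  rcases hu.eq_or_lt with h | h
  · subst h
    rw [Real.zero_rpow (by linarith), Real.zero_rpow (by linarith)]
    simpa using Real.rpow_nonneg hm r
  · have hb := one_add_mul_self_le_rpow_one_add (s := m / u - 1) (p := r)
      (by have := div_nonneg hm hu; linarith) hr.le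
    have e : 1 + (m / u - 1) = m / u := by ring
    rw [e, Real.div_rpow hm hu, le_div_iff₀ (Real.rpow_pos_of_pos h r)] at hb
    have e2 : u ^ r = u ^ (r - 1) * u := by
      rw [← Real.rpow_add_one h.ne', sub_add_cancel]
    refine le_trans (le_of_eq ?_) hb
    rw [e2]
    field_simp

/-- The Bregman divergence of `x ↦ x ^ r`. -/
noncomputable def powBregman (r a u : ℝ) : ℝ := a ^ r - u ^ r - r * u ^ (r - 1) * (a - u)

/-- The power of the mean is bounded below by its tangent line at `a`, the value at `false`. This
one-sided choice makes only decrements towards `false` appear later. -/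
lemma twoPointEntropy_le_bregman {r θ a b : ℝ} (hr : 1 < r) (hθ0 : 0 ≤ θ) (hθ1 : θ ≤ 1)
    (ha : 0 ≤ a) (hb : 0 ≤ b) : twoPointEntropy r θ a b ≤ θ * powBregman r b a := by
  have h := rpow_tangent_le hr ha
    (add_nonneg (mul_nonneg (sub_nonneg.2 hθ1) ha) (mul_nonneg hθ0 hb))
  unfold twoPointEntropy powBregman
  nlinarith

/-- The right side minus the left vanishes at `s = 1` and is nonincreasing on `[0, 1]`: its
derivative is `q (1 + (q-1)(s-1) - s^(q-1))`, which Bernoulli's inequality makes nonpositive. -/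
lemma rpow_le_quadratic {q s : ℝ} (hq : 2 ≤ q) (hs0 : 0 ≤ s) (hs1 : s ≤ 1) :
    s ^ q ≤ 1 + q * (s - 1) + q * (q - 1) / 2 * (s - 1) ^ 2 := by
  have hd : ∀ x : ℝ, HasDerivAt
      (fun s : ℝ => 1 + q * (s - 1) + q * (q - 1) / 2 * (s - 1) ^ 2 - s ^ q)
      (q + q * (q - 1) * (x - 1) - q * x ^ (q - 1)) x := by
    intro x
    have h1 : HasDerivAt (fun s : ℝ => s - 1) 1 x := (hasDerivAt_id x).sub_const 1
    have h2 : HasDerivAt (fun s : ℝ => s ^ q) (1 * q * x ^ (q - 1)) x :=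
      (hasDerivAt_id x).rpow_const (Or.inr (by linarith))
    have := ((((h1.const_mul q).const_add 1).add ((h1.pow 2).const_mul (q * (q - 1) / 2)))).sub h2
    refine HasDerivAt.congr_deriv this ?_
    push_cast
    ring
  have hanti := antitoneOn_of_deriv_nonpos (convex_Icc (0 : ℝ) 1)
    (fun x _ => (hd x).continuousAt.continuousWithinAt)
    (fun x _ => (hd x).differentiableAt.differentiableWithinAt) (fun x hx => by
      rw [(hd x).deriv]
      have hx := interior_subset hx
      have hb := one_add_mul_self_le_rpow_one_add (s := x - 1) (p := q - 1)
        (by linarith [hx.1]) (by linarith)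
      have e : 1 + (x - 1) = x := by ring
      rw [e] at hb
      nlinarith)
  have := hanti ⟨hs0, hs1⟩ (Set.right_mem_Icc.2 zero_le_one) hs1
  simp only [sub_self, mul_zero, add_zero, Real.one_rpow, ne_eq, OfNat.ofNat_ne_zero,
    not_false_eq_true, zero_pow] at this
  linarith

/-- The Bregman divergence along the power `q - 1` is controlled by a squared increment. -/
lemma powBregman_rpow_le {q z u : ℝ} (hq : 2 ≤ q) (hu : 0 ≤ u) (huz : u ≤ z) :
    powBregman (q / (q - 1)) (z ^ (q - 1)) (u ^ (q - 1)) ≤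
      q / 2 * ((z - u) ^ 2 * z ^ (q - 2)) := by
  have hq1 : 0 < q - 1 := by linarith
  have hz : 0 ≤ z := hu.trans huz
  have e1 : ∀ x : ℝ, 0 ≤ x → (x ^ (q - 1)) ^ (q / (q - 1)) = x ^ q := by
    intro x hx
    rw [← Real.rpow_mul hx]; congr 1; field_simp
  have e2 : (u ^ (q - 1)) ^ (q / (q - 1) - 1) = u := by
    rw [← Real.rpow_mul hu]
    have : (q - 1) * (q / (q - 1) - 1) = 1 := by field_simp; ring
    rw [this, Real.rpow_one]
  unfold powBregman
  rw [e1 z hz, e1 u hu, e2]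
  rcases hz.eq_or_lt with h | h
  · have hu0 : u = 0 := le_antisymm (h ▸ huz) hu
    subst hu0
    rw [← h]
    simp
  · have hs := rpow_le_quadratic (s := u / z) hq (div_nonneg hu hz) ((div_le_one h).2 huz)
    rw [Real.div_rpow hu hz, div_le_iff₀ (Real.rpow_pos_of_pos h q)] at hs
    have f1 : z ^ (q - 1) = z ^ (q - 2) * z := by
      rw [← Real.rpow_add_one h.ne']; ring_nf
    have f2 : z ^ q = z ^ (q - 2) * z ^ 2 := by
      rw [← Real.rpow_natCast z 2, ← Real.rpow_add h]; norm_num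
    have f3 : u * u ^ (q - 1) = u ^ q := by
      rcases hu.eq_or_lt with h' | h'
      · rw [← h', Real.zero_rpow (by linarith : q ≠ 0), zero_mul]
      · rw [mul_comm, ← Real.rpow_add_one h'.ne']; ring_nf
    have f4 : (1 + q * (u / z - 1) + q * (q - 1) / 2 * (u / z - 1) ^ 2) * z ^ q =
        z ^ (q - 2) * (z ^ 2 + q * (u - z) * z + q * (q - 1) / 2 * (u - z) ^ 2) := by
      rw [f2]; field_simp
    rw [f4] at hs
    have f5 : q / (q - 1) * u * (z ^ (q - 1) - u ^ (q - 1)) =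
        (q * u * z ^ (q - 1) - q * u ^ q) / (q - 1) := by
      rw [← f3]; field_simp
    rw [f5, sub_le_iff_le_add, ← sub_le_iff_le_add', le_div_iff₀ hq1, f2, f1]
    nlinarith

/-! ### Product Bernoulli expectations on the cube. -/

/-- The probability of a point of the cube under a product of Bernoulli laws. -/
def cubeWeight {n : ℕ} (p : Fin n → ℝ) (x : Fin n → Bool) : ℝ := ∏ i, bif x i then p i else 1 - p i

/-- The expectation of a function on the cube under a product of Bernoulli laws. -/
def cubeExp {n : ℕ} (p : Fin n → ℝ) (f : (Fin n → Bool) → ℝ) : ℝ := ∑ x, cubeWeight p x * f x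

lemma cubeExp_succ {n : ℕ} (p : Fin (n + 1) → ℝ) (f : (Fin (n + 1) → Bool) → ℝ) :
    cubeExp p f = (1 - p 0) * cubeExp (fun i => p i.succ) (fun y => f (Fin.cons false y)) +
      p 0 * cubeExp (fun i => p i.succ) (fun y => f (Fin.cons true y)) := by
  unfold cubeExp
  rw [← (Fin.consEquiv (fun _ : Fin (n + 1) => Bool)).sum_comp, Fintype.sum_prod_type,
    Fintype.sum_bool, add_comm, Finset.mul_sum, Finset.mul_sum]
  congr 1 <;> refine Finset.sum_congr rfl fun y _ => ?_ <;>
    simp [cubeWeight, Fin.consEquiv, Fin.prod_univ_succ, mul_assoc]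

lemma cubeWeight_nonneg {n : ℕ} {p : Fin n → ℝ} (hp : ∀ i, p i ∈ Set.Icc (0 : ℝ) 1)
    (x : Fin n → Bool) : 0 ≤ cubeWeight p x := by
  refine Finset.prod_nonneg fun i _ => ?_
  cases x i
  · simpa using (hp i).2
  · simpa using (hp i).1

lemma cubeExp_const {n : ℕ} (p : Fin n → ℝ) (c : ℝ) : cubeExp p (fun _ => c) = c := by
  induction n with
  | zero => simp [cubeExp, cubeWeight]
  | succ n ih => rw [cubeExp_succ, ih]; ring

lemma sum_cubeWeight {n : ℕ} (p : Fin n → ℝ) : ∑ x, cubeWeight p x = 1 := by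
  simpa [cubeExp] using cubeExp_const p 1

section cubeExp_linear

variable {n : ℕ} (p : Fin n → ℝ)

lemma cubeExp_add (f g : (Fin n → Bool) → ℝ) :
    cubeExp p (fun x => f x + g x) = cubeExp p f + cubeExp p g := by
  simp [cubeExp, mul_add, Finset.sum_add_distrib]

lemma cubeExp_sub (f g : (Fin n → Bool) → ℝ) :
    cubeExp p (fun x => f x - g x) = cubeExp p f - cubeExp p g := by
  simp [cubeExp, mul_sub, Finset.sum_sub_distrib]

lemma cubeExp_const_mul (c : ℝ) (f : (Fin n → Bool) → ℝ) :
    cubeExp p (fun x => c * f x) = c * cubeExp p f := by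
  simp only [cubeExp, Finset.mul_sum]
  exact Finset.sum_congr rfl fun x _ => by ring

lemma cubeExp_sum {ι : Type*} (s : Finset ι) (f : ι → (Fin n → Bool) → ℝ) :
    cubeExp p (fun x => ∑ i ∈ s, f i x) = ∑ i ∈ s, cubeExp p (f i) := by
  simp only [cubeExp, Finset.mul_sum]
  exact Finset.sum_comm

variable {p}

lemma cubeExp_mono (hp : ∀ i, p i ∈ Set.Icc (0 : ℝ) 1) {f g : (Fin n → Bool) → ℝ}
    (h : ∀ x, f x ≤ g x) : cubeExp p f ≤ cubeExp p g :=
  Finset.sum_le_sum fun x _ => mul_le_mul_of_nonneg_left (h x) (cubeWeight_nonneg hp x)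

lemma cubeExp_nonneg (hp : ∀ i, p i ∈ Set.Icc (0 : ℝ) 1) {f : (Fin n → Bool) → ℝ}
    (h : ∀ x, 0 ≤ f x) : 0 ≤ cubeExp p f :=
  Finset.sum_nonneg fun x _ => mul_nonneg (cubeWeight_nonneg hp x) (h x)

end cubeExp_linear

/-- Averaging over one coordinate does not change the expectation. -/
lemma cubeExp_update {n : ℕ} (p : Fin n → ℝ) (i : Fin n) (g : (Fin n → Bool) → ℝ) :
    cubeExp p (fun x => (1 - p i) * g (Function.update x i false) +
      p i * g (Function.update x i true)) = cubeExp p g := by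
  induction n with
  | zero => exact i.elim0
  | succ n ih =>
    rw [cubeExp_succ, cubeExp_succ p g]
    cases i using Fin.cases with
    | zero =>
      simp only [Fin.update_cons_zero, cubeExp_add, cubeExp_const_mul]
      ring
    | succ i =>
      simp only [← Fin.cons_update]
      rw [ih (fun i => p i.succ) i (fun y => g (Fin.cons false y)),
        ih (fun i => p i.succ) i (fun y => g (Fin.cons true y))]

/-! ### Subadditivity of the power entropy. -/

/-- Tensorization of the power entropy on the cube. -/
lemma cubeExp_rpow_sub_le_sum_twoPointEntropy {n : ℕ} {p : Fin n → ℝ}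
    (hp : ∀ i, p i ∈ Set.Icc (0 : ℝ) 1) {r : ℝ} (hr1 : 1 ≤ r) (hr2 : r ≤ 2)
    {f : (Fin n → Bool) → ℝ} (hf : ∀ x, 0 ≤ f x) :
    cubeExp p (fun x => f x ^ r) - (cubeExp p f) ^ r ≤
      ∑ i, cubeExp p (fun x => twoPointEntropy r (p i) (f (Function.update x i false))
        (f (Function.update x i true))) := by
  induction n with
  | zero => simp [cubeExp, cubeWeight]
  | succ n ih =>
    have h0 := ih (p := fun i => p i.succ) (fun i => hp i.succ)
      (f := fun y => f (Fin.cons false y)) (fun _ => hf _)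
    have h1 := ih (p := fun i => p i.succ) (fun i => hp i.succ)
      (f := fun y => f (Fin.cons true y)) (fun _ => hf _)
    -- Jensen for the jointly convex two-point entropy: averaging over the other coordinates first
    -- can only lower the entropy in coordinate `0`.
    have hJ : twoPointEntropy r (p 0)
        (cubeExp (fun i => p i.succ) (fun y => f (Fin.cons false y)))
        (cubeExp (fun i => p i.succ) (fun y => f (Fin.cons true y))) ≤
        cubeExp (fun i => p i.succ) (fun y => twoPointEntropy r (p 0) (f (Fin.cons false y))
          (f (Fin.cons true y))) := by
      have := (convexOn_twoPointEntropy hr1 hr2 (hp 0).1 (hp 0).2).map_sum_le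
        (t := Finset.univ) (w := cubeWeight (fun i => p i.succ))
        (p := fun y => (f (Fin.cons false y), f (Fin.cons true y)))
        (fun y _ => cubeWeight_nonneg (fun i => hp i.succ) y) (sum_cubeWeight _)
        (fun y _ => ⟨hf _, hf _⟩)
      simpa [cubeExp, Prod.fst_sum, Prod.snd_sum] using this
    rw [Fin.sum_univ_succ, cubeExp_succ p f, cubeExp_succ p (fun x => f x ^ r),
      cubeExp_succ p (fun x => twoPointEntropy r (p 0) _ _)]
    simp only [cubeExp_succ p (fun x => twoPointEntropy r (p (Fin.succ _)) _ _),
      Fin.update_cons_zero, ← Fin.cons_update, Finset.sum_add_distrib, ← Finset.mul_sum]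
    have a0 := mul_le_mul_of_nonneg_left h0 (sub_nonneg.2 (hp 0).2)
    have a1 := mul_le_mul_of_nonneg_left h1 (hp 0).1
    unfold twoPointEntropy at hJ a0 a1 ⊢
    nlinarith

lemma cubeExp_rpow_sub_le_sum_bregman {n : ℕ} {p : Fin n → ℝ}
    (hp : ∀ i, p i ∈ Set.Icc (0 : ℝ) 1) {r : ℝ} (hr1 : 1 < r) (hr2 : r ≤ 2)
    {f : (Fin n → Bool) → ℝ} (hf : ∀ x, 0 ≤ f x) :
    cubeExp p (fun x => f x ^ r) - (cubeExp p f) ^ r ≤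
      ∑ i, cubeExp p (fun x => powBregman r (f x) (f (Function.update x i false))) := by
  refine (cubeExp_rpow_sub_le_sum_twoPointEntropy hp hr1.le hr2 hf).trans
    (Finset.sum_le_sum fun i _ => ?_)
  -- After averaging over coordinate `i` the comparison is pointwise; the `false` branch contributes
  -- a Bregman divergence of a value from itself, which is zero.
  rw [← cubeExp_update p i fun x => powBregman r (f x) (f (Function.update x i false))]
  refine cubeExp_mono hp fun x => ?_
  have h := twoPointEntropy_le_bregman (r := r) hr1 (hp i).1 (hp i).2
    (hf (Function.update x i false)) (hf (Function.update x i true))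
  have h0 : ∀ a, powBregman r a a = 0 := fun a => by simp [powBregman]
  simpa [Function.update_idem, h0] using h

/-! ### Norms on the cube: Minkowski, Hölder, monotonicity in the exponent. -/

/-- The `L^q` norm of a nonnegative function on the cube. -/
noncomputable def cubeNorm {n : ℕ} (p : Fin n → ℝ) (q : ℝ) (f : (Fin n → Bool) → ℝ) : ℝ :=
  (cubeExp p fun x => f x ^ q) ^ (1 / q)

section cubeNorm

variable {n : ℕ} {p : Fin n → ℝ}

lemma cubeNorm_nonneg (hp : ∀ i, p i ∈ Set.Icc (0 : ℝ) 1) (q : ℝ) {f : (Fin n → Bool) → ℝ}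
    (hf : ∀ x, 0 ≤ f x) : 0 ≤ cubeNorm p q f :=
  Real.rpow_nonneg (cubeExp_nonneg hp fun x => Real.rpow_nonneg (hf x) q) _

lemma cubeNorm_rpow (hp : ∀ i, p i ∈ Set.Icc (0 : ℝ) 1) {q : ℝ} (hq : 0 < q)
    {f : (Fin n → Bool) → ℝ} (hf : ∀ x, 0 ≤ f x) :
    cubeNorm p q f ^ q = cubeExp p fun x => f x ^ q := by
  unfold cubeNorm
  rw [← Real.rpow_mul (cubeExp_nonneg hp fun x => Real.rpow_nonneg (hf x) q),
    one_div_mul_cancel hq.ne', Real.rpow_one]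

lemma cubeNorm_mono (hp : ∀ i, p i ∈ Set.Icc (0 : ℝ) 1) {q : ℝ} (hq : 0 < q)
    {f g : (Fin n → Bool) → ℝ} (hf : ∀ x, 0 ≤ f x) (hfg : ∀ x, f x ≤ g x) :
    cubeNorm p q f ≤ cubeNorm p q g :=
  Real.rpow_le_rpow (cubeExp_nonneg hp fun x => Real.rpow_nonneg (hf x) q)
    (cubeExp_mono hp fun x => Real.rpow_le_rpow (hf x) (hfg x) hq.le) (by positivity)

lemma cubeNorm_const {q : ℝ} (hq : 0 < q) {c : ℝ} (hc : 0 ≤ c) :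
    cubeNorm p q (fun _ => c) = c := by
  unfold cubeNorm
  rw [cubeExp_const, ← Real.rpow_mul hc, mul_one_div_cancel hq.ne', Real.rpow_one]

lemma cubeNorm_const_mul (hp : ∀ i, p i ∈ Set.Icc (0 : ℝ) 1) {q : ℝ} (hq : 0 < q) {c : ℝ}
    (hc : 0 ≤ c) {f : (Fin n → Bool) → ℝ} (hf : ∀ x, 0 ≤ f x) :
    cubeNorm p q (fun x => c * f x) = c * cubeNorm p q f := by
  have h : ∀ x, (c * f x) ^ q = c ^ q * f x ^ q := fun x => Real.mul_rpow hc (hf x)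
  unfold cubeNorm
  simp only [h]
  rw [cubeExp_const_mul, Real.mul_rpow (Real.rpow_nonneg hc q)
    (cubeExp_nonneg hp fun x => Real.rpow_nonneg (hf x) q), ← Real.rpow_mul hc,
    mul_one_div_cancel hq.ne', Real.rpow_one]

lemma cubeNorm_eq_sum (hp : ∀ i, p i ∈ Set.Icc (0 : ℝ) 1) {q : ℝ} (hq : 0 < q)
    {f : (Fin n → Bool) → ℝ} (hf : ∀ x, 0 ≤ f x) :
    cubeNorm p q f = (∑ x, (cubeWeight p x ^ (1 / q) * f x) ^ q) ^ (1 / q) := by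
  unfold cubeNorm cubeExp
  congr 1
  refine Finset.sum_congr rfl fun x _ => ?_
  have hw := cubeWeight_nonneg hp x
  rw [Real.mul_rpow (Real.rpow_nonneg hw _) (hf x), ← Real.rpow_mul hw,
    one_div_mul_cancel hq.ne', Real.rpow_one]

lemma cubeNorm_add_le (hp : ∀ i, p i ∈ Set.Icc (0 : ℝ) 1) {q : ℝ} (hq : 1 ≤ q)
    {f g : (Fin n → Bool) → ℝ} (hf : ∀ x, 0 ≤ f x) (hg : ∀ x, 0 ≤ g x) :
    cubeNorm p q (fun x => f x + g x) ≤ cubeNorm p q f + cubeNorm p q g := by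
  have hq0 : 0 < q := by linarith
  have hw : ∀ x, 0 ≤ cubeWeight p x ^ (1 / q) := fun x =>
    Real.rpow_nonneg (cubeWeight_nonneg hp x) _
  rw [cubeNorm_eq_sum hp hq0 hf, cubeNorm_eq_sum hp hq0 hg,
    cubeNorm_eq_sum hp hq0 fun x => add_nonneg (hf x) (hg x)]
  simp only [mul_add]
  exact Real.Lp_add_le_of_nonneg _ hq (fun x _ => mul_nonneg (hw x) (hf x))
    fun x _ => mul_nonneg (hw x) (hg x)

/-- Hölder's inequality on the cube. -/
lemma cubeExp_mul_le (hp : ∀ i, p i ∈ Set.Icc (0 : ℝ) 1) {a b : ℝ} (hab : a.HolderConjugate b)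
    {f g : (Fin n → Bool) → ℝ} (hf : ∀ x, 0 ≤ f x) (hg : ∀ x, 0 ≤ g x) :
    cubeExp p (fun x => f x * g x) ≤ cubeNorm p a f * cubeNorm p b g := by
  have hw : ∀ (c : ℝ) x, 0 ≤ cubeWeight p x ^ (1 / c) := fun c x =>
    Real.rpow_nonneg (cubeWeight_nonneg hp x) _
  rw [cubeNorm_eq_sum hp hab.pos hf, cubeNorm_eq_sum hp hab.symm.pos hg]
  refine le_trans (le_of_eq ?_) (Real.inner_le_Lp_mul_Lq_of_nonneg _ hab
    (fun x _ => mul_nonneg (hw a x) (hf x)) fun x _ => mul_nonneg (hw b x) (hg x))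
  refine Finset.sum_congr rfl fun x _ => ?_
  have e : cubeWeight p x = cubeWeight p x ^ (1 / a) * cubeWeight p x ^ (1 / b) := by
    have h1 : 1 / a + 1 / b = 1 := by
      have := hab.inv_add_inv_eq_one; simpa [one_div] using this
    rw [← Real.rpow_add_of_nonneg (cubeWeight_nonneg hp x) (one_div_nonneg.2 hab.nonneg)
      (one_div_nonneg.2 hab.symm.nonneg), h1, Real.rpow_one]
  nth_rewrite 1 [e]
  ring

lemma cubeNorm_le_cubeNorm (hp : ∀ i, p i ∈ Set.Icc (0 : ℝ) 1) {q q' : ℝ} (hq : 0 < q)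
    (hqq : q ≤ q') {f : (Fin n → Bool) → ℝ} (hf : ∀ x, 0 ≤ f x) :
    cubeNorm p q f ≤ cubeNorm p q' f := by
  have hq' : 0 < q' := by linarith
  have h := Real.rpow_arith_mean_le_arith_mean_rpow Finset.univ (cubeWeight p)
    (fun x => f x ^ q) (fun x _ => cubeWeight_nonneg hp x) (sum_cubeWeight p)
    (fun x _ => Real.rpow_nonneg (hf x) q) (p := q' / q) ((one_le_div hq).2 hqq)
  have e : ∀ x, (f x ^ q) ^ (q' / q) = f x ^ q' := fun x => by
    rw [← Real.rpow_mul (hf x), mul_div_cancel₀ _ hq.ne']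
  simp only [e] at h
  have h0 : 0 ≤ cubeExp p fun x => f x ^ q :=
    cubeExp_nonneg hp fun x => Real.rpow_nonneg (hf x) q
  have h2 := Real.rpow_le_rpow (Real.rpow_nonneg h0 _) h (z := 1 / q') (by positivity)
  change (cubeExp p (fun x => f x ^ q) ^ (q' / q)) ^ (1 / q') ≤ _ at h2
  rw [← Real.rpow_mul h0] at h2
  have e2 : q' / q * (1 / q') = 1 / q := by field_simp
  rw [e2] at h2
  exact h2

end cubeNorm

/-! ### Moments of the upper deviation of a monotone function. -/

/-- The sum of the squared decrements of `Z` when one coordinate is set to `false`. -/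
def sqDecrement {n : ℕ} (Z : (Fin n → Bool) → ℝ) (x : Fin n → Bool) : ℝ :=
  ∑ i, (Z x - Z (Function.update x i false)) ^ 2

/-- The positive part of the centered function `Z`. -/
noncomputable def upperDev {n : ℕ} (p : Fin n → ℝ) (Z : (Fin n → Bool) → ℝ) (x : Fin n → Bool) :
    ℝ :=
  max (Z x - cubeExp p Z) 0

lemma sqDecrement_nonneg {n : ℕ} (Z : (Fin n → Bool) → ℝ) (x : Fin n → Bool) :
    0 ≤ sqDecrement Z x := Finset.sum_nonneg fun _ _ => sq_nonneg _

lemma upperDev_nonneg {n : ℕ} (p : Fin n → ℝ) (Z : (Fin n → Bool) → ℝ) (x : Fin n → Bool) :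
    0 ≤ upperDev p Z x := le_max_right _ _

section moments

variable {n : ℕ} {p : Fin n → ℝ} {Z : (Fin n → Bool) → ℝ}

/-- Subadditivity with `r = q/(q-1)`, applied to the power `q - 1` of the upper deviation. The
positive part is monotone and 1-Lipschitz, so its decrements are bounded by those of `Z`. -/
lemma cubeExp_upperDev_rpow_le (hp : ∀ i, p i ∈ Set.Icc (0 : ℝ) 1)
    (hZ : ∀ i x, Z (Function.update x i false) ≤ Z x) {q : ℝ} (hq : 2 ≤ q) :
    cubeExp p (fun x => upperDev p Z x ^ q) ≤
      (cubeExp p fun x => upperDev p Z x ^ (q - 1)) ^ (q / (q - 1)) +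
        q / 2 * cubeExp p (fun x => sqDecrement Z x * upperDev p Z x ^ (q - 2)) := by
  have hq1 : 0 < q - 1 := by linarith
  have h := cubeExp_rpow_sub_le_sum_bregman hp (r := q / (q - 1))
    ((one_lt_div hq1).2 (by linarith)) ((div_le_iff₀ hq1).2 (by linarith))
    (f := fun x => upperDev p Z x ^ (q - 1)) fun x => Real.rpow_nonneg (upperDev_nonneg p Z x) _
  have e : ∀ x, (upperDev p Z x ^ (q - 1)) ^ (q / (q - 1)) = upperDev p Z x ^ q := fun x => by
    rw [← Real.rpow_mul (upperDev_nonneg p Z x), mul_div_cancel₀ _ hq1.ne']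
  simp only [e] at h
  rw [← cubeExp_sum] at h
  rw [← cubeExp_const_mul, ← sub_le_iff_le_add']
  refine h.trans (cubeExp_mono hp fun x => ?_)
  unfold sqDecrement
  rw [Finset.sum_mul, Finset.mul_sum]
  refine Finset.sum_le_sum fun i _ => ?_
  have hle : upperDev p Z (Function.update x i false) ≤ upperDev p Z x :=
    max_le_max (sub_le_sub_right (hZ i x) _) le_rfl
  have hlip : upperDev p Z x - upperDev p Z (Function.update x i false) ≤
      Z x - Z (Function.update x i false) := by
    have h1 : Z (Function.update x i false) - cubeExp p Z ≤
        upperDev p Z (Function.update x i false) := le_max_left _ _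
    have h2 := upperDev_nonneg p Z (Function.update x i false)
    have h3 := hZ i x
    rw [sub_le_iff_le_add]
    exact max_le (by linarith) (by linarith)
  refine (powBregman_rpow_le hq (upperDev_nonneg p Z _) hle).trans ?_
  have := pow_le_pow_left₀ (sub_nonneg.2 hle) hlip 2
  have h0 := Real.rpow_nonneg (upperDev_nonneg p Z x) (q - 2)
  gcongr

/-- The Efron–Stein inequality for the upper deviation. -/
lemma cubeExp_upperDev_sq_le (hp : ∀ i, p i ∈ Set.Icc (0 : ℝ) 1) (hZ0 : ∀ x, 0 ≤ Z x) :
    cubeExp p (fun x => upperDev p Z x ^ 2) ≤ cubeExp p (sqDecrement Z) := by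
  have h := cubeExp_rpow_sub_le_sum_bregman hp (r := 2) (by norm_num) le_rfl hZ0
  rw [← cubeExp_sum] at h
  have hb : ∀ a u : ℝ, powBregman 2 a u = (a - u) ^ 2 := by
    intro a u
    unfold powBregman
    norm_num
    ring
  simp only [hb, Real.rpow_two] at h
  refine le_trans ?_ h
  have e : cubeExp p (fun x => (Z x - cubeExp p Z) ^ 2) =
      cubeExp p (fun x => Z x ^ 2) - cubeExp p Z ^ 2 := by
    have : ∀ x, (Z x - cubeExp p Z) ^ 2 =
        Z x ^ 2 - (2 * cubeExp p Z * Z x - cubeExp p Z ^ 2) := fun x => by ring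
    simp only [this]
    rw [cubeExp_sub, cubeExp_sub, cubeExp_const_mul, cubeExp_const]
    ring
  rw [← e]
  refine cubeExp_mono hp fun x => ?_
  unfold upperDev
  rcases max_cases (Z x - cubeExp p Z) 0 with ⟨h1, _⟩ | ⟨h1, _⟩
  · rw [h1]
  · rw [h1, zero_pow two_ne_zero]; exact sq_nonneg _

lemma cubeExp_mul_rpow_le (hp : ∀ i, p i ∈ Set.Icc (0 : ℝ) 1) {q : ℝ} (hq : 2 ≤ q)
    {V D : (Fin n → Bool) → ℝ} (hV : ∀ x, 0 ≤ V x) (hD : ∀ x, 0 ≤ D x) :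
    cubeExp p (fun x => V x * D x ^ (q - 2)) ≤
      cubeNorm p (q / 2) V * cubeNorm p q D ^ (q - 2) := by
  rcases hq.eq_or_lt with h | h
  -- At `q = 2` the conjugate exponent of `q/2` would be infinite, but the second factor is the
  -- constant `1`.
  · subst h
    simp [cubeNorm]
  · have hab : (q / 2).HolderConjugate (q / (q - 2)) := by
      have : 0 < q - 2 := by linarith
      rw [Real.holderConjugate_iff]
      refine ⟨by linarith, ?_⟩
      field_simp
      ring
    refine (cubeExp_mul_le hp hab hV fun x => Real.rpow_nonneg (hD x) _).trans (le_of_eq ?_)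
    congr 1
    have hq2 : q - 2 ≠ 0 := by linarith
    unfold cubeNorm
    have e : ∀ x, (D x ^ (q - 2)) ^ (q / (q - 2)) = D x ^ q := fun x => by
      rw [← Real.rpow_mul (hD x), mul_div_cancel₀ _ hq2]
    simp only [e]
    rw [← Real.rpow_mul (cubeExp_nonneg hp fun x => Real.rpow_nonneg (hD x) q)]
    congr 1
    field_simp

lemma one_lt_sqrt_exp_one : 1 < Real.sqrt (Real.exp 1) := by
  rw [Real.lt_sqrt zero_le_one]
  simp

lemma two_mul_kappa_mul : 2 * kappa * (1 - Real.exp (-(1 / 2))) = 1 := by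
  have h := one_lt_sqrt_exp_one
  have e : Real.exp (-(1 / 2)) = (Real.sqrt (Real.exp 1))⁻¹ := by
    rw [Real.exp_neg, Real.sqrt_eq_rpow, ← Real.exp_mul]
    norm_num
  rw [e, kappa]
  have h1 : Real.sqrt (Real.exp 1) - 1 ≠ 0 := by linarith
  have h2 : Real.sqrt (Real.exp 1) ≠ 0 := by linarith
  field_simp

lemma one_le_kappa : 1 ≤ kappa := by
  have h := one_lt_sqrt_exp_one
  have h2 : Real.sqrt (Real.exp 1) ≤ 2 := by
    rw [Real.sqrt_le_left (by norm_num)]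
    have := Real.exp_one_lt_d9
    linarith
  rw [kappa, le_div_iff₀ (by linarith)]
  linarith

/-- The induction step on the exponent in the moment inequality. -/
lemma sq_le_kappa_mul_of_rpow_le {q v m m' : ℝ} (hq : 2 ≤ q) (hv : 0 ≤ v) (hm : 0 ≤ m)
    (hm' : 0 ≤ m') (h' : m' ^ 2 ≤ kappa * (q - 1) * v)
    (h : m ^ q ≤ m' ^ q + q / 2 * (v * m ^ (q - 2))) : m ^ 2 ≤ kappa * q * v := by
  -- If `m² > K = κ q v`, then `m'^q ≤ (1 - 1/q)^(q/2) K^(q/2) ≤ e^(-1/2) K m^(q-2)`, while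
  -- `two_mul_kappa_mul` makes the other term exactly `(1 - e^(-1/2)) K m^(q-2)`. Together `m^q ≤ K
  -- m^(q-2)`, a contradiction.
  by_contra! hcon
  have hk := one_le_kappa
  have hk2 := two_mul_kappa_mul
  set K := kappa * q * v with hK
  have hK0 : 0 ≤ K := by positivity
  have hmpos : 0 < m := hm.lt_of_ne fun h0 => by
    rw [← h0] at hcon
    norm_num at hcon
    linarith
  have hP : 0 < m ^ (q - 2) := Real.rpow_pos_of_pos hmpos _
  have e1 : m ^ q = m ^ 2 * m ^ (q - 2) := by
    rw [← Real.rpow_natCast m 2, ← Real.rpow_add hmpos]; norm_num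
  have hKP : K ^ (q / 2 - 1) ≤ m ^ (q - 2) := by
    have := Real.rpow_le_rpow hK0 hcon.le (z := q / 2 - 1) (by linarith)
    rwa [← Real.rpow_natCast m 2, ← Real.rpow_mul hm,
      show ((2 : ℕ) : ℝ) * (q / 2 - 1) = q - 2 by push_cast; ring] at this
  have hKq : K ^ (q / 2) ≤ K * m ^ (q - 2) := by
    rcases hK0.eq_or_lt with h0 | h0
    · rw [← h0, Real.zero_rpow (by linarith)]; simp
    · have : K ^ (q / 2) = K * K ^ (q / 2 - 1) := by
        rw [mul_comm, ← Real.rpow_add_one h0.ne', sub_add_cancel]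
      rw [this]
      exact mul_le_mul_of_nonneg_left hKP hK0
  have hexp : (1 - 1 / q) ^ (q / 2) ≤ Real.exp (-(1 / 2)) := by
    have h0 : 0 ≤ 1 - 1 / q := by
      rw [sub_nonneg, div_le_one (by linarith)]; linarith
    have h1 : 1 - 1 / q ≤ Real.exp (-(1 / q)) := Real.one_sub_le_exp_neg _
    refine (Real.rpow_le_rpow h0 h1 (by linarith)).trans (le_of_eq ?_)
    rw [← Real.exp_mul]
    congr 1
    field_simp
  have hm'q : m' ^ q ≤ Real.exp (-(1 / 2)) * (K * m ^ (q - 2)) := by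
    have e2 : m' ^ q = (m' ^ 2) ^ (q / 2) := by
      rw [← Real.rpow_natCast m' 2, ← Real.rpow_mul hm']
      congr 1
      push_cast
      ring
    have e3 : kappa * (q - 1) * v = (1 - 1 / q) * K := by
      rw [hK]; field_simp
    have h0 : 0 ≤ 1 - 1 / q := by
      rw [sub_nonneg, div_le_one (by linarith)]; linarith
    rw [e2]
    rw [e3] at h'
    refine (Real.rpow_le_rpow (sq_nonneg _) h' (by linarith)).trans ?_
    rw [Real.mul_rpow h0 hK0]
    exact mul_le_mul hexp hKq (Real.rpow_nonneg hK0 _) (Real.exp_pos _).le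
  have e4 : q / 2 * v = (1 - Real.exp (-(1 / 2))) * K := by
    have : (1 - Real.exp (-(1 / 2))) * K =
      (2 * kappa * (1 - Real.exp (-(1 / 2)))) * (q / 2 * v) := by rw [hK]; ring
    rw [this, hk2, one_mul]
  rw [← mul_assoc, e4, e1] at h
  have : m ^ 2 * m ^ (q - 2) ≤ K * m ^ (q - 2) := by linarith
  exact absurd (le_of_mul_le_mul_right this hP) (not_le.2 hcon)

/-- The exponent `Q/2` on the right is frozen so that the bounds at `q - 1` and at `q` involve the
same quantity; the natural number `k` only counts unit steps in the real exponent `q`. -/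
lemma cubeNorm_upperDev_sq_le_of_le (hp : ∀ i, p i ∈ Set.Icc (0 : ℝ) 1) (hZ0 : ∀ x, 0 ≤ Z x)
    (hZ : ∀ i x, Z (Function.update x i false) ≤ Z x) {Q : ℝ} (hQ : 2 ≤ Q) (k : ℕ) :
    ∀ q : ℝ, 1 ≤ q → q ≤ Q → q ≤ k + 2 →
      cubeNorm p q (upperDev p Z) ^ 2 ≤ kappa * q * cubeNorm p (Q / 2) (sqDecrement Z) := by
  have hk := one_le_kappa
  have hv := cubeNorm_nonneg hp (Q / 2) (sqDecrement_nonneg Z)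
  have hD := upperDev_nonneg p Z
  induction k with
  | zero =>
    intro q hq1 _ hq2
    have h1 := cubeNorm_le_cubeNorm hp (by linarith) (by simpa using hq2 : q ≤ 2) hD
    have h2 := cubeExp_upperDev_sq_le hp hZ0
    have h3 := cubeNorm_le_cubeNorm hp one_pos (by linarith : 1 ≤ Q / 2) (sqDecrement_nonneg Z)
    have h4 : cubeNorm p 2 (upperDev p Z) ^ 2 = cubeExp p fun x => upperDev p Z x ^ 2 := by
      have := cubeNorm_rpow hp two_pos hD
      simpa only [Real.rpow_two] using this
    have h5 : cubeNorm p 1 (sqDecrement Z) = cubeExp p (sqDecrement Z) := by simp [cubeNorm]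
    calc cubeNorm p q (upperDev p Z) ^ 2 ≤ cubeNorm p 2 (upperDev p Z) ^ 2 :=
          pow_le_pow_left₀ (cubeNorm_nonneg hp q hD) h1 2
      _ ≤ cubeNorm p (Q / 2) (sqDecrement Z) := by rw [h4]; exact (h2.trans h5.ge).trans h3
      _ ≤ _ := le_mul_of_one_le_left hv (one_le_mul_of_one_le_of_one_le hk hq1)
  | succ k ih =>
    intro q hq1 hqQ hqk
    by_cases hq2 : q ≤ 2
    · exact ih q hq1 hqQ (by have : (0 : ℝ) ≤ k := k.cast_nonneg; linarith)
    push Not at hq2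
    push_cast at hqk
    have hi := ih (q - 1) (by linarith) (by linarith) (by linarith)
    refine sq_le_kappa_mul_of_rpow_le hq2.le hv (cubeNorm_nonneg hp q hD)
      (cubeNorm_nonneg hp (q - 1) hD) hi ?_
    rw [cubeNorm_rpow hp (by linarith) hD]
    have e : cubeNorm p (q - 1) (upperDev p Z) ^ q =
        (cubeExp p fun x => upperDev p Z x ^ (q - 1)) ^ (q / (q - 1)) := by
      unfold cubeNorm
      rw [← Real.rpow_mul (cubeExp_nonneg hp fun x => Real.rpow_nonneg (hD x) _)]
      congr 1
      ring
    rw [e]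
    refine (cubeExp_upperDev_rpow_le hp hZ hq2.le).trans ?_
    have h1 := cubeExp_mul_rpow_le hp hq2.le (sqDecrement_nonneg Z) hD
    have h2 := cubeNorm_le_cubeNorm hp (by linarith : 0 < q / 2) (by linarith : q / 2 ≤ Q / 2)
      (sqDecrement_nonneg Z)
    have h3 := Real.rpow_nonneg (cubeNorm_nonneg hp q hD) (q - 2)
    have h4 := h1.trans (mul_le_mul_of_nonneg_right h2 h3)
    gcongr

/-- The moment inequality for the upper deviation of a coordinatewise monotone function. -/
theorem cubeNorm_upperDev_sq_le (hp : ∀ i, p i ∈ Set.Icc (0 : ℝ) 1) (hZ0 : ∀ x, 0 ≤ Z x)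
    (hZ : ∀ i x, Z (Function.update x i false) ≤ Z x) {q : ℝ} (hq : 2 ≤ q) :
    cubeNorm p q (upperDev p Z) ^ 2 ≤ kappa * q * cubeNorm p (q / 2) (sqDecrement Z) := by
  obtain ⟨k, hk⟩ := exists_nat_ge q
  exact cubeNorm_upperDev_sq_le_of_le hp hZ0 hZ hq k q (by linarith) le_rfl (by linarith)

lemma cubeNorm_le_cubeExp_add (hp : ∀ i, p i ∈ Set.Icc (0 : ℝ) 1) (hZ0 : ∀ x, 0 ≤ Z x) {q : ℝ}
    (hq : 1 ≤ q) : cubeNorm p q Z ≤ cubeExp p Z + cubeNorm p q (upperDev p Z) := by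
  have h0 := cubeExp_nonneg hp hZ0
  calc cubeNorm p q Z ≤ cubeNorm p q (fun x => cubeExp p Z + upperDev p Z x) :=
        cubeNorm_mono hp (by linarith) hZ0 fun x => by
          have : Z x - cubeExp p Z ≤ upperDev p Z x := le_max_left _ _
          linarith
    _ ≤ cubeNorm p q (fun _ => cubeExp p Z) + cubeNorm p q (upperDev p Z) :=
        cubeNorm_add_le hp hq (fun _ => h0) (upperDev_nonneg p Z)
    _ = _ := by rw [cubeNorm_const (by linarith) h0]

/-! ### Self-bounded functions. -/

/-- The moment inequality for self-bounded functions, in quadratic form. -/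
lemma cubeNorm_upperDev_sq_le_of_selfBounded (hp : ∀ i, p i ∈ Set.Icc (0 : ℝ) 1)
    (hZ0 : ∀ x, 0 ≤ Z x) (hZ : ∀ i x, Z (Function.update x i false) ≤ Z x)
    {W : (Fin n → Bool) → ℝ} (hW : ∀ x, 0 ≤ W x) (hV : ∀ x, sqDecrement Z x ≤ W x * Z x) {q : ℝ}
    (hq : 2 ≤ q) :
    cubeNorm p q (upperDev p Z) ^ 2 ≤
      kappa * q * cubeNorm p q W * (cubeExp p Z + cubeNorm p q (upperDev p Z)) := by
  have hq0 : 0 < q := by linarith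
  have hk := one_le_kappa
  have h1 : cubeNorm p (q / 2) (sqDecrement Z) ≤ cubeNorm p q W * cubeNorm p q Z := by
    refine (cubeNorm_mono hp (by linarith) (sqDecrement_nonneg Z) hV).trans ?_
    have hc := cubeExp_mul_le hp Real.HolderConjugate.two_two
      (fun x => Real.rpow_nonneg (hW x) (q / 2)) (fun x => Real.rpow_nonneg (hZ0 x) (q / 2))
    have e : ∀ f : (Fin n → Bool) → ℝ, (∀ x, 0 ≤ f x) →
        cubeNorm p 2 (fun x => f x ^ (q / 2)) = (cubeExp p fun x => f x ^ q) ^ (1 / 2 : ℝ) := by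
      intro f hf
      unfold cubeNorm
      congr 2
      funext x
      rw [← Real.rpow_mul (hf x)]
      congr 1
      ring
    rw [e W hW, e Z hZ0] at hc
    have e2 : ∀ x, W x ^ (q / 2) * Z x ^ (q / 2) = (W x * Z x) ^ (q / 2) := fun x =>
      (Real.mul_rpow (hW x) (hZ0 x)).symm
    simp only [e2] at hc
    have hWq := cubeExp_nonneg hp fun x => Real.rpow_nonneg (hW x) q
    have hZq := cubeExp_nonneg hp fun x => Real.rpow_nonneg (hZ0 x) q
    have h := Real.rpow_le_rpow
      (cubeExp_nonneg hp fun x => Real.rpow_nonneg (mul_nonneg (hW x) (hZ0 x)) (q / 2)) hc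
      (z := 1 / (q / 2)) (by positivity)
    rw [Real.mul_rpow (Real.rpow_nonneg hWq _) (Real.rpow_nonneg hZq _), ← Real.rpow_mul hWq,
      ← Real.rpow_mul hZq, show (1 / 2 : ℝ) * (1 / (q / 2)) = 1 / q by field_simp] at h
    exact h
  have hWn := cubeNorm_nonneg hp q hW
  calc cubeNorm p q (upperDev p Z) ^ 2 ≤ kappa * q * cubeNorm p (q / 2) (sqDecrement Z) :=
        cubeNorm_upperDev_sq_le hp hZ0 hZ hq
    _ ≤ kappa * q * (cubeNorm p q W * (cubeExp p Z + cubeNorm p q (upperDev p Z))) := by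
        have h2 := h1.trans (mul_le_mul_of_nonneg_left
          (cubeNorm_le_cubeExp_add hp hZ0 (by linarith : 1 ≤ q)) hWn)
        gcongr
    _ = _ := by ring

/-- With `m = ‖(Z - E Z)_+‖_q` and `w = κ q ‖W‖_q`, the inequality `m² ≤ w (E Z + m)` forces `m ≤ w
+ E Z`. This form is linear in `E Z` and `w`, so it can be iterated. -/
lemma cubeNorm_le_of_selfBounded (hp : ∀ i, p i ∈ Set.Icc (0 : ℝ) 1)
    (hZ0 : ∀ x, 0 ≤ Z x) (hZ : ∀ i x, Z (Function.update x i false) ≤ Z x)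
    {W : (Fin n → Bool) → ℝ} (hW : ∀ x, 0 ≤ W x) (hV : ∀ x, sqDecrement Z x ≤ W x * Z x) {q : ℝ}
    (hq : 2 ≤ q) :
    cubeNorm p q Z ≤ 2 * cubeExp p Z + kappa * q * cubeNorm p q W := by
  have h1 := cubeNorm_upperDev_sq_le_of_selfBounded hp hZ0 hZ hW hV hq
  have h2 := cubeNorm_le_cubeExp_add hp hZ0 (by linarith : 1 ≤ q)
  have hk := one_le_kappa
  have hw : 0 ≤ kappa * q * cubeNorm p q W := by
    have := cubeNorm_nonneg hp q hW
    positivity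
  have hE := cubeExp_nonneg hp hZ0
  generalize kappa * q * cubeNorm p q W = w at *
  generalize cubeExp p Z = E at *
  have : cubeNorm p q (upperDev p Z) ≤ w + E := by
    by_contra! h
    nlinarith
  linarith

/-- The sharper solution `m ≤ √(w E Z) + w` of the same quadratic inequality, reserved for the top
level. -/
lemma cubeNorm_upperDev_le_of_selfBounded (hp : ∀ i, p i ∈ Set.Icc (0 : ℝ) 1)
    (hZ0 : ∀ x, 0 ≤ Z x) (hZ : ∀ i x, Z (Function.update x i false) ≤ Z x)
    {W : (Fin n → Bool) → ℝ} (hW : ∀ x, 0 ≤ W x) (hV : ∀ x, sqDecrement Z x ≤ W x * Z x) {q : ℝ}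
    (hq : 2 ≤ q) :
    cubeNorm p q (upperDev p Z) ≤
      Real.sqrt (kappa * q * cubeNorm p q W * cubeExp p Z) + kappa * q * cubeNorm p q W := by
  have h1 := cubeNorm_upperDev_sq_le_of_selfBounded hp hZ0 hZ hW hV hq
  have hk := one_le_kappa
  have hw : 0 ≤ kappa * q * cubeNorm p q W := by
    have := cubeNorm_nonneg hp q hW
    positivity
  have hE := cubeExp_nonneg hp hZ0
  generalize kappa * q * cubeNorm p q W = w at *
  generalize cubeExp p Z = E at *
  have hs := Real.sq_sqrt (mul_nonneg hw hE)
  have hs0 := Real.sqrt_nonneg (w * E)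
  by_contra! h
  nlinarith

end moments

/-! ### Suprema of Boolean polynomials and their self-bounding property. -/

section combinatorics

variable {n d : ℕ}

/-- The part of the Boolean polynomial with coefficients `t` that is divisible by `∏_{j ∈ J} y_j`,
divided by this product. -/
def partialSum (J : Finset (Fin n)) (t : SubsetsOfSize n d → ℝ) (y : Fin n → ℝ) : ℝ :=
  ∑ I : SubsetsOfSize n d with J ⊆ I.1, (∏ i ∈ I.1 \ J, y i) * t I

/-- The terms of `partialSum` in which the variable `i` occurs. -/
def partialSumAt (J : Finset (Fin n)) (t : SubsetsOfSize n d → ℝ) (y : Fin n → ℝ) (i : Fin n) : ℝ :=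
  ∑ I : SubsetsOfSize n d with J ⊆ I.1, if i ∈ I.1 \ J then (∏ j ∈ I.1 \ J, y j) * t I else 0

lemma continuous_partialSum (J : Finset (Fin n)) (y : Fin n → ℝ) :
    Continuous fun t : SubsetsOfSize n d → ℝ => partialSum J t y :=
  continuous_finsetSum _ fun I _ => continuous_const.mul (continuous_apply I)

lemma exists_iSup_eq_partialSum {T : Set (SubsetsOfSize n d → ℝ)} (hTne : T.Nonempty)
    (hT : IsCompact T) (J : Finset (Fin n)) (y : Fin n → ℝ) :
    ∃ t ∈ T, (⨆ s : T, partialSum J s.1 y) = partialSum J t y ∧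
      ∀ s ∈ T, partialSum J s y ≤ partialSum J t y := by
  obtain ⟨t, ht, hmax⟩ := hT.exists_isMaxOn hTne (continuous_partialSum J y).continuousOn
  have hmax' : ∀ s ∈ T, partialSum J s y ≤ partialSum J t y := fun s hs => hmax hs
  have : Nonempty T := ⟨⟨t, ht⟩⟩
  refine ⟨t, ht, le_antisymm (ciSup_le fun s => hmax' s.1 s.2) ?_, hmax'⟩
  exact le_ciSup (f := fun s : T => partialSum J s.1 y)
    ⟨partialSum J t y, by rintro _ ⟨s, rfl⟩; exact hmax' s.1 s.2⟩ ⟨t, ht⟩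

lemma exists_maxPartial_eq (hdn : d ≤ n) {T : Set (SubsetsOfSize n d → ℝ)} (hTne : T.Nonempty)
    (hT : IsCompact T) (k : ℕ) (y : Fin n → ℝ) :
    ∃ J : Finset (Fin n), J.card = d - k ∧ ∃ t ∈ T, maxPartial T k y = partialSum J t y := by
  have : Nonempty (SubsetsOfSize n (d - k)) := by
    obtain ⟨J, -, hJ⟩ := Finset.exists_subset_card_eq
      (s := (Finset.univ : Finset (Fin n))) (n := d - k) (by simp; omega)
    exact ⟨⟨J, hJ⟩⟩
  obtain ⟨J, hJ⟩ := exists_eq_ciSup_of_finite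
    (f := fun J : SubsetsOfSize n (d - k) => ⨆ t : T, partialSum J.1 t.1 y)
  obtain ⟨t, ht, h, -⟩ := exists_iSup_eq_partialSum hTne hT J.1 y
  exact ⟨J.1, J.2, t, ht, hJ.symm.trans h⟩

lemma partialSum_le_maxPartial {T : Set (SubsetsOfSize n d → ℝ)} (hT : IsCompact T) {k : ℕ}
    (y : Fin n → ℝ) {J : Finset (Fin n)} (hJ : J.card = d - k) {t : SubsetsOfSize n d → ℝ}
    (ht : t ∈ T) : partialSum J t y ≤ maxPartial T k y := by
  obtain ⟨s, hs, h, hmax⟩ := exists_iSup_eq_partialSum ⟨t, ht⟩ hT J y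
  refine (hmax t ht).trans (h.ge.trans ?_)
  exact le_ciSup (f := fun J : SubsetsOfSize n (d - k) => ⨆ t : T, partialSum J.1 t.1 y)
    (Set.finite_range _).bddAbove ⟨J, hJ⟩

/-- At `k = d` the only admissible `J` is empty. Thus `Z` is the top member of the family `M_k`, and
one self-bounding lemma serves all levels. -/
lemma maxPartial_self_eq_boolSup (hdn : d ≤ n) {T : Set (SubsetsOfSize n d → ℝ)}
    (hTne : T.Nonempty) (hT : IsCompact T) (y : Fin n → ℝ) : maxPartial T d y = boolSup T y := by
  have e : boolSup T y = ⨆ t : T, partialSum ∅ t.1 y := by simp [boolSup, partialSum]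
  obtain ⟨s, hs, h, hmax⟩ := exists_iSup_eq_partialSum hTne hT ∅ y
  obtain ⟨J, hJ, t, ht, h'⟩ := exists_maxPartial_eq hdn hTne hT d y
  rw [Nat.sub_self, Finset.card_eq_zero] at hJ
  subst hJ
  rw [e, h]
  refine le_antisymm (h' ▸ hmax t ht) (partialSum_le_maxPartial hT y (by simp) hs)

lemma partialSum_nonneg {t : SubsetsOfSize n d → ℝ} (ht : ∀ I, 0 ≤ t I) {y : Fin n → ℝ}
    (hy : ∀ i, 0 ≤ y i) (J : Finset (Fin n)) : 0 ≤ partialSum J t y :=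
  Finset.sum_nonneg fun I _ => mul_nonneg (Finset.prod_nonneg fun i _ => hy i) (ht I)

lemma partialSumAt_nonneg {t : SubsetsOfSize n d → ℝ} (ht : ∀ I, 0 ≤ t I) {y : Fin n → ℝ}
    (hy : ∀ i, 0 ≤ y i) (J : Finset (Fin n)) (i : Fin n) : 0 ≤ partialSumAt J t y i :=
  Finset.sum_nonneg fun I _ => by
    split_ifs
    · exact mul_nonneg (Finset.prod_nonneg fun i _ => hy i) (ht I)
    · exact le_rfl

lemma maxPartial_nonneg (hdn : d ≤ n) {T : Set (SubsetsOfSize n d → ℝ)} (hTne : T.Nonempty)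
    (hT : IsCompact T) (hT0 : ∀ t ∈ T, ∀ I, 0 ≤ t I) (k : ℕ) {y : Fin n → ℝ}
    (hy : ∀ i, 0 ≤ y i) : 0 ≤ maxPartial T k y := by
  obtain ⟨J, -, t, ht, h⟩ := exists_maxPartial_eq hdn hTne hT k y
  exact h ▸ partialSum_nonneg (hT0 t ht) hy J

lemma partialSum_sub_update (J : Finset (Fin n)) (t : SubsetsOfSize n d → ℝ) (y : Fin n → ℝ)
    (i : Fin n) :
    partialSum J t y - partialSum J t (Function.update y i 0) = partialSumAt J t y i := by
  unfold partialSum partialSumAt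
  rw [← Finset.sum_sub_distrib]
  refine Finset.sum_congr rfl fun I _ => ?_
  split_ifs with h
  · rw [Finset.prod_eq_zero (f := fun j => Function.update y i 0 j) h (by simp)]
    ring
  · rw [Finset.prod_update_of_notMem h, sub_self]

/-- Euler's identity: every monomial has degree `|I \ J| = k`, hence is counted once for each of its
`k` variables. -/
lemma sum_partialSumAt {k : ℕ} (hk : k ≤ d) {J : Finset (Fin n)} (hJ : J.card = d - k)
    (t : SubsetsOfSize n d → ℝ) (y : Fin n → ℝ) :
    ∑ i, partialSumAt J t y i = k * partialSum J t y := by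
  unfold partialSum partialSumAt
  rw [Finset.sum_comm, Finset.mul_sum]
  refine Finset.sum_congr rfl fun I hI => ?_
  have hJI : J ⊆ I.1 := (Finset.mem_filter.1 hI).2
  have hc : (I.1 \ J).card = k := by
    rw [Finset.card_sdiff_of_subset hJI, hJ, I.2]
    omega
  rw [Finset.sum_ite_mem, Finset.univ_inter, Finset.sum_const, hc, nsmul_eq_mul]

lemma partialSumAt_eq_mul (J : Finset (Fin n)) (t : SubsetsOfSize n d → ℝ) (y : Fin n → ℝ)
    {i : Fin n} (hi : i ∉ J) : partialSumAt J t y i = y i * partialSum (insert i J) t y := by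
  unfold partialSum partialSumAt
  rw [← Finset.sum_filter, Finset.filter_filter, Finset.mul_sum]
  have hf : ∀ I : SubsetsOfSize n d, (J ⊆ I.1 ∧ i ∈ I.1 \ J) ↔ insert i J ⊆ I.1 := fun I => by
    rw [Finset.insert_subset_iff, Finset.mem_sdiff]; tauto
  simp only [hf]
  refine Finset.sum_congr rfl fun I hI => ?_
  have hm : i ∈ I.1 \ J := ((hf I).2 (Finset.mem_filter.1 hI).2).2
  rw [← Finset.mul_prod_erase _ _ hm, ← Finset.sdiff_insert, mul_assoc]

lemma partialSumAt_eq_zero {J : Finset (Fin n)} (t : SubsetsOfSize n d → ℝ) (y : Fin n → ℝ)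
    {i : Fin n} (hi : i ∈ J) : partialSumAt J t y i = 0 :=
  Finset.sum_eq_zero fun _ _ => if_neg fun h => (Finset.mem_sdiff.1 h).2 hi

lemma partialSumAt_le_maxPartial (hdn : d ≤ n) {T : Set (SubsetsOfSize n d → ℝ)}
    (hT : IsCompact T) (hT0 : ∀ t ∈ T, ∀ I, 0 ≤ t I) {k : ℕ} (hk : k ≤ d) {y : Fin n → ℝ}
    (hy0 : ∀ i, 0 ≤ y i) (hy1 : ∀ i, y i ≤ 1) {J : Finset (Fin n)} (hJ : J.card = d - k)
    {t : SubsetsOfSize n d → ℝ} (ht : t ∈ T) (i : Fin n) :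
    partialSumAt J t y i ≤ maxPartial T (k - 1) y := by
  have h0 := maxPartial_nonneg hdn ⟨t, ht⟩ hT hT0 (k - 1) hy0
  by_cases hi : i ∈ J
  · rwa [partialSumAt_eq_zero t y hi]
  -- For `k = 0` the truncated index `k - 1` is `0`, but no variables remain, so the left side
  -- vanishes.
  rcases Nat.eq_zero_or_pos k with rfl | hk0
  · have hs := sum_partialSumAt hk hJ t y
    rw [Nat.cast_zero, zero_mul] at hs
    rwa [(Finset.sum_eq_zero_iff_of_nonneg
      fun i _ => partialSumAt_nonneg (hT0 t ht) hy0 J i).1 hs i (Finset.mem_univ i)]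
  · rw [partialSumAt_eq_mul J t y hi]
    refine (mul_le_of_le_one_left (partialSum_nonneg (hT0 t ht) hy0 _) (hy1 i)).trans ?_
    refine partialSum_le_maxPartial hT y ?_ ht
    rw [Finset.card_insert_of_notMem hi, hJ]
    omega

lemma maxPartial_update_le (hdn : d ≤ n) {T : Set (SubsetsOfSize n d → ℝ)} (hTne : T.Nonempty)
    (hT : IsCompact T) (hT0 : ∀ t ∈ T, ∀ I, 0 ≤ t I) (k : ℕ) {y : Fin n → ℝ}
    (hy0 : ∀ i, 0 ≤ y i) (i : Fin n) :
    maxPartial T k (Function.update y i 0) ≤ maxPartial T k y := by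
  obtain ⟨J, hJ, t, ht, h⟩ := exists_maxPartial_eq hdn hTne hT k (Function.update y i 0)
  have h1 := partialSum_le_maxPartial hT y hJ ht
  have h2 := partialSum_sub_update J t y i
  have h3 := partialSumAt_nonneg (hT0 t ht) hy0 J i
  linarith

/-- The self-bounding property of suprema of Boolean polynomials. -/
lemma sum_sq_maxPartial_sub_le (hdn : d ≤ n) {T : Set (SubsetsOfSize n d → ℝ)}
    (hTne : T.Nonempty) (hT : IsCompact T) (hT0 : ∀ t ∈ T, ∀ I, 0 ≤ t I) {k : ℕ} (hk : k ≤ d)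
    {y : Fin n → ℝ} (hy0 : ∀ i, 0 ≤ y i) (hy1 : ∀ i, y i ≤ 1) :
    ∑ i, (maxPartial T k y - maxPartial T k (Function.update y i 0)) ^ 2 ≤
      k * maxPartial T (k - 1) y * maxPartial T k y := by
  obtain ⟨J, hJ, t, ht, h⟩ := exists_maxPartial_eq hdn hTne hT k y
  -- The optimal pair `(J, t)` at `y` is still a competitor after switching off `i`, so each
  -- decrement is at most `partialSumAt J t y i`; one factor of its square is then bounded by
  -- `maxPartial T (k - 1) y`.
  calc ∑ i, (maxPartial T k y - maxPartial T k (Function.update y i 0)) ^ 2 ≤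
        ∑ i, maxPartial T (k - 1) y * partialSumAt J t y i := by
        refine Finset.sum_le_sum fun i _ => ?_
        have h1 := partialSum_le_maxPartial hT (Function.update y i 0) hJ ht
        have h2 := partialSum_sub_update J t y i
        have h3 := sub_nonneg.2 (maxPartial_update_le hdn hTne hT hT0 k hy0 i)
        have h4 := partialSumAt_le_maxPartial hdn hT hT0 hk hy0 hy1 hJ ht i
        have h5 : maxPartial T k y - maxPartial T k (Function.update y i 0) ≤
            partialSumAt J t y i := by linarith
        rw [sq]
        exact mul_le_mul (h5.trans h4) h5 h3 (h3.trans (h5.trans h4))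
    _ = _ := by
        rw [← Finset.mul_sum, sum_partialSumAt hk hJ, ← h]
        ring

end combinatorics

/-! ### The recursion in `k` and the inequality on the cube. -/

/-- The real point of the cube with the given Boolean coordinates. -/
def cubePoint {n : ℕ} (x : Fin n → Bool) (i : Fin n) : ℝ := bif x i then 1 else 0

lemma cubePoint_update_false {n : ℕ} (x : Fin n → Bool) (i : Fin n) :
    cubePoint (Function.update x i false) = Function.update (cubePoint x) i 0 := by
  funext j
  by_cases h : j = i
  · subst h; simp [cubePoint]
  · simp [cubePoint, h]

lemma cubePoint_nonneg {n : ℕ} (x : Fin n → Bool) (i : Fin n) : 0 ≤ cubePoint x i := by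
  unfold cubePoint; cases x i <;> simp

lemma cubePoint_le_one {n : ℕ} (x : Fin n → Bool) (i : Fin n) : cubePoint x i ≤ 1 := by
  unfold cubePoint; cases x i <;> simp

/-- Unfolding of a linear recursion with factorial growth. -/
lemma le_sum_of_le_add_mul {c : ℝ} (hc : 0 ≤ c) {N e : ℕ → ℝ} {d : ℕ}
    (h : ∀ k ≤ d, N k ≤ 2 * e k + c * k * N (k - 1)) :
    ∀ k ≤ d, N k ≤ 2 * ∑ i ∈ Finset.range (k + 1),
      c ^ i * ((k.factorial : ℝ) / ((k - i).factorial : ℝ)) * e (k - i) := by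
  intro k
  induction k with
  | zero => intro hk; simpa using h 0 hk
  | succ k ih =>
    intro hk
    have h1 := h (k + 1) hk
    have h2 := mul_le_mul_of_nonneg_left (ih (by omega))
      (by positivity : 0 ≤ c * ((k + 1 : ℕ) : ℝ))
    rw [Nat.add_sub_cancel] at h1
    have hsum : ∑ i ∈ Finset.range (k + 1 + 1),
        c ^ i * (((k + 1).factorial : ℝ) / ((k + 1 - i).factorial : ℝ)) * e (k + 1 - i) =
        c * ((k + 1 : ℕ) : ℝ) * (∑ i ∈ Finset.range (k + 1),
          c ^ i * ((k.factorial : ℝ) / ((k - i).factorial : ℝ)) * e (k - i)) + e (k + 1) := by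
      rw [Finset.sum_range_succ', Finset.mul_sum]
      congr 1
      · refine Finset.sum_congr rfl fun i _ => ?_
        rw [Nat.add_sub_add_right, Nat.factorial_succ]
        push_cast
        ring
      · have : ((k + 1).factorial : ℝ) ≠ 0 := by positivity
        simp [this]
    rw [hsum]
    linarith

/-- Unrolling stops at level `d - 1` and the last factor `c d` is put in by hand, because level `d`
is treated by the square-root bound. The index shift makes the sum start at `j = 1`. -/
lemma mul_le_sum_of_le_add_mul {c : ℝ} (hc : 0 ≤ c) {N e : ℕ → ℝ} {d : ℕ}
    (h : ∀ k ≤ d, N k ≤ 2 * e k + c * k * N (k - 1)) :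
    c * d * N (d - 1) ≤ 2 * ∑ j ∈ Finset.Icc 1 d,
      c ^ j * ((d.factorial : ℝ) / ((d - j).factorial : ℝ)) * e (d - j) := by
  cases d with
  | zero => simp
  | succ k =>
    have h1 := mul_le_mul_of_nonneg_left (le_sum_of_le_add_mul hc h k (by omega))
      (by positivity : 0 ≤ c * ((k + 1 : ℕ) : ℝ))
    rw [Nat.add_sub_cancel]
    refine h1.trans (le_of_eq ?_)
    rw [mul_left_comm, Finset.mul_sum, Finset.range_eq_Ico,
      ← Finset.Ico_add_one_right_eq_Icc 1 (k + 1), Finset.sum_Ico_eq_sum_range,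
      Finset.sum_Ico_eq_sum_range]
    congr 1
    refine Finset.sum_congr rfl fun i _ => ?_
    rw [zero_add, add_comm 1 i, Nat.add_sub_add_right, Nat.factorial_succ]
    push_cast
    ring

lemma sqrt_sum_le_sum_sqrt {ι : Type*} (s : Finset ι) {a : ι → ℝ} (ha : ∀ i ∈ s, 0 ≤ a i) :
    Real.sqrt (∑ i ∈ s, a i) ≤ ∑ i ∈ s, Real.sqrt (a i) := by
  rw [Real.sqrt_le_left (Finset.sum_nonneg fun i _ => Real.sqrt_nonneg _)]
  calc ∑ i ∈ s, a i = ∑ i ∈ s, Real.sqrt (a i) ^ 2 :=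
        Finset.sum_congr rfl fun i hi => (Real.sq_sqrt (ha i hi)).symm
    _ ≤ _ := Finset.sum_sq_le_sq_sum_of_nonneg fun i _ => Real.sqrt_nonneg _

/-- The moment inequality for suprema of Boolean polynomials, on the cube. -/
theorem cubeNorm_upperDev_maxPartial_le {n d : ℕ} (hdn : d ≤ n) {p : Fin n → ℝ}
    (hp : ∀ i, p i ∈ Set.Icc (0 : ℝ) 1) {T : Set (SubsetsOfSize n d → ℝ)} (hTne : T.Nonempty)
    (hT : IsCompact T) (hT0 : ∀ t ∈ T, ∀ I, 0 ≤ t I) {q : ℝ} (hq : 2 ≤ q) (e : ℕ → ℝ)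
    (he : ∀ k, e k = cubeExp p fun x => maxPartial T k (cubePoint x)) :
    cubeNorm p q (upperDev p fun x => maxPartial T d (cubePoint x)) ≤
      2 * ∑ j ∈ Finset.Icc 1 d,
        ((kappa * q) ^ ((j : ℝ) / 2) *
            Real.sqrt ((d.factorial : ℝ) / ((d - j).factorial : ℝ)) *
            Real.sqrt (e d * e (d - j)) +
          (kappa * q) ^ j * ((d.factorial : ℝ) / ((d - j).factorial : ℝ)) * e (d - j)) := by
  have hk1 := one_le_kappa
  have hc : 0 ≤ kappa * q := by positivity
  have hM0 : ∀ k x, 0 ≤ maxPartial T k (cubePoint x) := fun k x =>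
    maxPartial_nonneg hdn hTne hT hT0 k (cubePoint_nonneg x)
  have he0 : ∀ k, 0 ≤ e k := fun k => he k ▸ cubeExp_nonneg hp (hM0 k)
  have hmono : ∀ k i x, maxPartial T k (cubePoint (Function.update x i false)) ≤
      maxPartial T k (cubePoint x) := fun k i x => by
    rw [cubePoint_update_false]
    exact maxPartial_update_le hdn hTne hT hT0 k (cubePoint_nonneg x) i
  have hV : ∀ k ≤ d, ∀ x, sqDecrement (fun x => maxPartial T k (cubePoint x)) x ≤
      k * maxPartial T (k - 1) (cubePoint x) * maxPartial T k (cubePoint x) := fun k hk x => by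
    unfold sqDecrement
    simp only [cubePoint_update_false]
    exact sum_sq_maxPartial_sub_le hdn hTne hT hT0 hk (cubePoint_nonneg x) (cubePoint_le_one x)
  have hW0 : ∀ (k : ℕ) x, 0 ≤ (k : ℝ) * maxPartial T (k - 1) (cubePoint x) := fun k x =>
    mul_nonneg k.cast_nonneg (hM0 _ x)
  set N : ℕ → ℝ := fun k => cubeNorm p q fun x => maxPartial T k (cubePoint x) with hN
  have hNW : ∀ k : ℕ, kappa * q *
      cubeNorm p q (fun x => (k : ℝ) * maxPartial T (k - 1) (cubePoint x)) =
      kappa * q * k * N (k - 1) := fun k => by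
    rw [cubeNorm_const_mul hp (by linarith) k.cast_nonneg (hM0 _)]
    ring
  have hrec : ∀ k ≤ d, N k ≤ 2 * e k + kappa * q * k * N (k - 1) := fun k hk => by
    have := cubeNorm_le_of_selfBounded hp (hM0 k) (hmono k) (hW0 k) (hV k hk) hq
    rwa [hNW, ← he] at this
  have hS := mul_le_sum_of_le_add_mul hc hrec
  have hdev := cubeNorm_upperDev_le_of_selfBounded hp (hM0 d) (hmono d) (hW0 d) (hV d le_rfl) hq
  rw [hNW, ← he] at hdev
  have hsqrt : Real.sqrt (kappa * q * d * N (d - 1) * e d) ≤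
      2 * ∑ j ∈ Finset.Icc 1 d, (kappa * q) ^ ((j : ℝ) / 2) *
        Real.sqrt ((d.factorial : ℝ) / ((d - j).factorial : ℝ)) *
          Real.sqrt (e d * e (d - j)) := by
    have h1 := Real.sqrt_le_sqrt (mul_le_mul_of_nonneg_right hS (he0 d))
    refine h1.trans ?_
    rw [mul_assoc, Real.sqrt_mul zero_le_two, Finset.sum_mul]
    -- The square root of the recursion bound carries only `√2`; it is relaxed to `2` so that both
    -- sums share one prefactor.
    have h2 : Real.sqrt 2 ≤ 2 := by rw [Real.sqrt_le_left] <;> norm_num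
    refine mul_le_mul h2 ((sqrt_sum_le_sum_sqrt _ fun j _ => ?_).trans (le_of_eq ?_))
      (Real.sqrt_nonneg _) zero_le_two
    · have := he0 d
      have := he0 (d - j)
      positivity
    · refine Finset.sum_congr rfl fun j _ => ?_
      have e1 : (kappa * q) ^ ((j : ℝ) / 2) = Real.sqrt ((kappa * q) ^ j) := by
        rw [Real.sqrt_eq_rpow, ← Real.rpow_natCast, ← Real.rpow_mul hc]
        congr 1
        ring
      rw [e1, ← Real.sqrt_mul (by positivity), ← Real.sqrt_mul (by positivity)]
      congr 1
      ring
  rw [Finset.sum_add_distrib, mul_add]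
  linarith

/-! ### From independent variables to the cube. -/

section transfer

open MeasureTheory ProbabilityTheory

variable {Ω : Type*} [MeasurableSpace Ω] {μ : Measure Ω} [IsProbabilityMeasure μ] {n : ℕ}
  {B : Fin n → Ω → Bool}

/-- The law on the cube lives on a finite discrete space, where every function is measurable and
integrable; no measurability argument for suprema over `T` is needed. -/
lemma integrable_comp_cube (hB : ∀ i, Measurable (B i)) (g : (Fin n → Bool) → ℝ) :
    Integrable (fun ω => g fun i => B i ω) μ := by
  have hm : Measurable fun ω i => B i ω := measurable_pi_iff.2 hB
  exact (Integrable.of_finite (μ := μ.map fun ω i => B i ω) (f := g)).comp_measurable hm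

/-- The expectation of a function of independent Boolean variables. -/
lemma integral_comp_cube (hB : ∀ i, Measurable (B i)) (hind : iIndepFun B μ)
    (g : (Fin n → Bool) → ℝ) :
    ∫ ω, g (fun i => B i ω) ∂μ = cubeExp (fun i => μ.real (B i ⁻¹' {true})) g := by
  have hm : Measurable fun ω i => B i ω := measurable_pi_iff.2 hB
  rw [← integral_map (f := g) hm.aemeasurable (Measurable.of_discrete).aestronglyMeasurable,
    integral_fintype Integrable.of_finite]
  refine Finset.sum_congr rfl fun x _ => ?_
  rw [smul_eq_mul]
  congr 1
  have hpre : (fun ω i => B i ω) ⁻¹' {x} = ⋂ i ∈ Finset.univ, B i ⁻¹' {x i} := by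
    ext ω
    simp [funext_iff]
  rw [measureReal_def, Measure.map_apply hm (measurableSet_singleton x), hpre,
    hind.measure_inter_preimage_eq_mul Finset.univ (fun i _ => measurableSet_singleton (x i)),
    ENNReal.toReal_prod, cubeWeight]
  refine Finset.prod_congr rfl fun i _ => ?_
  rw [← measureReal_def]
  cases x i
  · have : B i ⁻¹' {false} = (B i ⁻¹' {true})ᶜ := by ext ω; simp
    rw [this, probReal_compl_eq_one_sub (hB i (measurableSet_singleton _))]
    simp
  · simp

end transfer

theorem theorem15 {Ω : Type*} [MeasurableSpace Ω] (μ : MeasureTheory.Measure Ω)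
    [MeasureTheory.IsProbabilityMeasure μ] (n d : ℕ) (hdn : d ≤ n)
    (X : Fin n → Ω → ℝ) (hXmeas : ∀ i, Measurable (X i))
    (hX01 : ∀ i ω, X i ω = 0 ∨ X i ω = 1)
    (hXindep : ProbabilityTheory.iIndepFun X μ)
    (T : Set (SubsetsOfSize n d → ℝ)) (hTne : T.Nonempty) (hTcomp : IsCompact T)
    (hTnonneg : ∀ t ∈ T, ∀ I, 0 ≤ t I)
    (Z : Ω → ℝ) (hZ : Z = fun ω => boolSup T (fun i => X i ω))
    (M : ℕ → Ω → ℝ) (hM : M = fun k ω => maxPartial T k (fun i => X i ω)) :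
    MeasureTheory.Integrable Z μ ∧
    (∀ k, k < d → MeasureTheory.Integrable (M k) μ) ∧
    ∀ q : ℝ, 2 ≤ q →
      MeasureTheory.eLpNorm (fun ω => max (Z ω - ∫ ω', Z ω' ∂μ) 0) (ENNReal.ofReal q) μ ≤
        ENNReal.ofReal (2 * ∑ j ∈ Finset.Icc 1 d,
          ((kappa * q) ^ ((j : ℝ) / 2) *
              Real.sqrt ((d.factorial : ℝ) / ((d - j).factorial : ℝ)) *
              Real.sqrt ((∫ ω, Z ω ∂μ) * ∫ ω, M (d - j) ω ∂μ) +
            (kappa * q) ^ j * ((d.factorial : ℝ) / ((d - j).factorial : ℝ)) *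
              ∫ ω, M (d - j) ω ∂μ)) := by
  -- Recoding the values `0, 1` as Booleans by a measurable map preserves independence and gives the
  -- variables a finite discrete range.
  set φ : ℝ → Bool := fun r => decide (r = 1) with hφ
  have hφm : Measurable φ := measurable_to_bool (by
    have : φ ⁻¹' {true} = {1} := by ext r; simp [hφ]
    rw [this]
    exact measurableSet_singleton 1)
  set B : Fin n → Ω → Bool := fun i => φ ∘ X i with hBdef
  have hB : ∀ i, Measurable (B i) := fun i => hφm.comp (hXmeas i)
  have hind : ProbabilityTheory.iIndepFun B μ := hXindep.comp (fun _ => φ) fun _ => hφm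
  have hXB : ∀ ω, (fun i => X i ω) = cubePoint fun i => B i ω := fun ω => by
    funext i
    rcases hX01 i ω with h | h <;> simp [cubePoint, hBdef, hφ, h]
  have hMB : ∀ k, M k = fun ω => maxPartial T k (cubePoint fun i => B i ω) := fun k => by
    rw [hM]
    funext ω
    simp only [hXB]
  have hZM : Z = M d := by
    rw [hZ, hM]
    funext ω
    exact (maxPartial_self_eq_boolSup hdn hTne hTcomp _).symm
  have hMint : ∀ k, MeasureTheory.Integrable (M k) μ := fun k => by
    rw [hMB k]
    exact integrable_comp_cube hB fun x => maxPartial T k (cubePoint x)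
  refine ⟨hZM ▸ hMint d, fun k _ => hMint k, fun q hq => ?_⟩
  set p : Fin n → ℝ := fun i => μ.real (B i ⁻¹' {true}) with hp
  have hp01 : ∀ i, p i ∈ Set.Icc (0 : ℝ) 1 := fun i =>
    ⟨MeasureTheory.measureReal_nonneg, MeasureTheory.measureReal_le_one⟩
  have hexp : ∀ k, ∫ ω, M k ω ∂μ = cubeExp p fun x => maxPartial T k (cubePoint x) := fun k => by
    rw [hMB k]
    exact integral_comp_cube hB hind fun x => maxPartial T k (cubePoint x)
  have hmain := cubeNorm_upperDev_maxPartial_le hdn hp01 hTne hTcomp hTnonneg hq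
    (fun k => ∫ ω, M k ω ∂μ) hexp
  rw [hZM]
  have hD : (fun ω => max (M d ω - ∫ ω', M d ω' ∂μ) 0) = fun ω =>
      upperDev p (fun x => maxPartial T d (cubePoint x)) fun i => B i ω := by
    rw [hexp d, hMB d]
    rfl
  have hq0 : 0 < q := by linarith
  have hLp : MeasureTheory.MemLp (fun ω =>
      upperDev p (fun x => maxPartial T d (cubePoint x)) fun i => B i ω) (ENNReal.ofReal q) μ := by
    have hm : Measurable fun ω i => B i ω := measurable_pi_iff.2 hB
    exact (MeasureTheory.MemLp.of_discrete (μ := μ.map fun ω i => B i ω)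
      (f := upperDev p fun x => maxPartial T d (cubePoint x))).comp_of_map hm.aemeasurable
  rw [hD, hLp.eLpNorm_eq_integral_rpow_norm (by simpa using hq0) ENNReal.ofReal_ne_top,
    ENNReal.toReal_ofReal hq0.le]
  refine ENNReal.ofReal_le_ofReal (le_trans (le_of_eq ?_) hmain)
  have hnorm : ∀ x, ‖upperDev p (fun x => maxPartial T d (cubePoint x)) x‖ =
      upperDev p (fun x => maxPartial T d (cubePoint x)) x := fun x =>
    Real.norm_of_nonneg (upperDev_nonneg p _ x)
  simp only [hnorm]
  rw [integral_comp_cube hB hind fun x =>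
    upperDev p (fun x => maxPartial T d (cubePoint x)) x ^ q, cubeNorm, one_div]
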